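/- A qustring of length $n$ is a unit vector $|\phi\rangle$ of $(\mathbb{C}^2)^{\otimes n}$, and $\Phi_n$ denotes the set of all of them. For a permutation $\sigma$ of $\{1,\dots,n\}$ and $|\phi\rangle=\sum_{x\in\{0,1\}^n}\alpha_x|x_1x_2\cdots x_n\rangle$ put $\sigma(|\phi\rangle)=\sum_{x}\alpha_x|x_{\sigma(1)}x_{\sigma(2)}\cdots x_{\sigma(n)}\rangle$. A qustring $|\phi\rangle\in\Phi_n$ is $k$-separable if $\sigma(|\phi\rangle)=|\phi_1\rangle\otimes\cdots\otimes|\phi_k\rangle$ for some permutation $\sigma$ and some qustrings $|\phi_1\rangle,\dots,|\phi_k\rangle$ of lengths at least $1$. Put $\|X\|_{\mathrm{tr}}=\frac12\mathrm{Tr}\sqrt{X^\dagger X}$. The $k$-separability distance $\mathrm{sdis}_k(|\xi\rangle)$ of $|\xi\rangle\in\Phi_n$ is the infimum of $\big\||\xi\rangle\langle\xi|-|\phi\rangle\langle\phi|\big\|_{\mathrm{tr}}$ over all $k$-separable $|\phi\rangle\in\Phi_n$. Let $S(\rho)=-\mathrm{Tr}(\rho\log\rho)$ be the von Neumann entropy.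 For $n\ge 2$ and $|\psi\rangle\in\Phi_n$ the average entropy is $$E(|\psi\rangle\langle\psi|)=\frac{1}{n-1}\sum_{i=2}^{n}S\big(\mathrm{Tr}_{\mathcal{H}_{\ge i}}(|\psi\rangle\langle\psi|)\big),$$ where $\mathrm{Tr}_{\mathcal{H}_{\ge i}}$ is the partial trace over the qubits $i,i+1,\dots,n$. All logarithms are to base $2$, and $0\log 0=0$. **Lemma.** Let $n\ge 2$, let $|\xi\rangle\in\Phi_n$ and let $k\in\{2,3,\dots,n\}$. If $\mathrm{sdis}_k(|\xi\rangle)\le 1/e$, then $$\min_{|\phi\rangle}\big|E(|\xi\rangle\langle\xi|)-E(|\phi\rangle\langle\phi|)\big|\le \mathrm{sdis}_k(|\xi\rangle)\,\big(n-\log \mathrm{sdis}_k(|\xi\rangle)\big),$$ where $|\phi\rangle$ ranges over all $k$-separable qustrings in $\Phi_n$. In particular, the minimum is attained. -/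

import Mathlib

open scoped Matrix

noncomputable section

/-- The Hilbert space of `n` qubits; the computational basis is indexed by the binary strings
`x : Fin n → Bool` of length `n`. -/
abbrev QubitSpace (n : ℕ) : Type := EuclideanSpace ℂ (Fin n → Bool)

/-- Qustrings of length `n`: unit vectors of the `n`-qubit space. -/
abbrev Qustring (n : ℕ) : Type := Metric.sphere (0 : QubitSpace n) 1

/-- The vector `∑ x, α x |x_{σ(1)} ⋯ x_{σ(n)}⟩`, where `φ = ∑ x, α x |x_1 ⋯ x_n⟩`: its amplitude
at the string `y` is the amplitude of `φ` at the string `x` with `y = x ∘ σ`. -/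
def permuteQubits {n : ℕ} (σ : Equiv.Perm (Fin n)) (φ : QubitSpace n) : QubitSpace n :=
  WithLp.toLp 2 fun y => φ (fun i => y (σ.symm i))

/-- The tensor product `φ_1 ⊗ ⋯ ⊗ φ_k` of vectors on `m_1, …, m_k` qubits, as a vector on
`n = m_1 + ⋯ + m_k` qubits. Its amplitude at the concatenation of strings `y_1, …, y_k` of lengths
`m_1, …, m_k` is the product of the amplitudes of `φ_j` at `y_j`; `finSigmaFinEquiv` numbers the
positions of the concatenation consecutively. -/
def tensorBlocks {n k : ℕ} (m : Fin k → ℕ) (hm : ∑ j, m j = n) (φ : ∀ j, QubitSpace (m j)) :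
    QubitSpace n :=
  WithLp.toLp 2 fun y => ∏ j, φ j (fun t => y (Fin.cast hm (finSigmaFinEquiv ⟨j, t⟩)))

/-- `φ` is `k`-separable: some permutation of its qubits turns it into a tensor product of
`k` qustrings of positive lengths. -/
def IsKSeparable {n : ℕ} (k : ℕ) (φ : Qustring n) : Prop :=
  ∃ (m : Fin k → ℕ) (hm : ∑ j, m j = n) (ψ : ∀ j, Qustring (m j)) (σ : Equiv.Perm (Fin n)),
    (∀ j, 1 ≤ m j) ∧
      permuteQubits σ (φ : QubitSpace n) = tensorBlocks m hm (fun j => (ψ j : QubitSpace (m j)))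

/-- The density matrix `|φ⟩⟨φ|`. -/
def ketbra {n : ℕ} (φ : Qustring n) : Matrix (Fin n → Bool) (Fin n → Bool) ℂ :=
  Matrix.of fun x y => (φ : QubitSpace n) x * star ((φ : QubitSpace n) y)

/-- The normalized trace norm `(1/2) Tr √(X† X)`; the square root is taken in the functional
calculus of Hermitian matrices. -/
def trNorm {ι : Type*} [Fintype ι] [DecidableEq ι] (X : Matrix ι ι ℂ) : ℝ :=
  1 / 2 * (Matrix.trace (cfc Real.sqrt (Xᴴ * X))).re

/-- The `k`-separability distance of `ξ`. -/
def sdis {n : ℕ} (k : ℕ) (ξ : Qustring n) : ℝ :=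
  sInf {d : ℝ | ∃ φ : Qustring n, IsKSeparable k φ ∧ d = trNorm (ketbra ξ - ketbra φ)}

/-- The von Neumann entropy `-Tr (ρ log₂ ρ)`. (`Real.logb 2 0 = 0`, so a zero eigenvalue of `ρ`
contributes `0`, as usual.) -/
def vonNeumannEntropy {ι : Type*} [Fintype ι] [DecidableEq ι] (ρ : Matrix ι ι ℂ) : ℝ :=
  -(Matrix.trace (ρ * cfc (Real.logb 2) ρ)).re

/-- The partial trace over the second factor of a bipartite system. -/
def partialTraceRight {α β : Type*} [Fintype β] (ρ : Matrix (α × β) (α × β) ℂ) : Matrix α α ℂ :=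
  Matrix.of fun a a' => ∑ b, ρ (a, b) (a', b)

/-- The reduced state that remains after tracing out the qubits with numbers `i, i + 1, …, n`
(qubits are numbered from `1`, so `q : Fin n` is the qubit with number `q + 1`). -/
def traceOutFrom {n : ℕ} (i : ℕ) (ρ : Matrix (Fin n → Bool) (Fin n → Bool) ℂ) :
    Matrix ({q : Fin n // (q : ℕ) + 1 < i} → Bool) ({q : Fin n // (q : ℕ) + 1 < i} → Bool) ℂ :=
  partialTraceRight
    (Matrix.reindex
      (Equiv.piEquivPiSubtypeProd (fun q : Fin n => (q : ℕ) + 1 < i) fun _ => Bool)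
      (Equiv.piEquivPiSubtypeProd (fun q : Fin n => (q : ℕ) + 1 < i) fun _ => Bool) ρ)

/-- The average entropy of a qustring of length `n` with density matrix `ρ`. -/
def averageEntropy {n : ℕ} (ρ : Matrix (Fin n → Bool) (Fin n → Bool) ℂ) : ℝ :=
  1 / ((n : ℝ) - 1) * ∑ i ∈ Finset.Icc 2 n, vonNeumannEntropy (traceOutFrom i ρ)

end

/-! The $k$-separable qustrings form a nonempty compact set on which trace distance and average
entropy are continuous, so both minima are attained. Evaluating the entropy gap at a separable
$\psi$ closest to $\xi$ leaves a continuity estimate for entropy in $T=\mathrm{sdis}_k(\xi)$.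

For each cut that estimate is of Fannes type. Measuring both reduced states in an eigenbasis of one
of them fixes the entropy of that one, cannot lower the other
(`OrthonormalBasis.sum_negMulLog_eigenvalues_le`), and yields distributions at distance at most $T$
(`OrthonormalBasis.sum_abs_quadForm_partialTraceRight_le`). The classical bound
`sum_negMulLog_sub_le` then gives $T(2m-\log_2 T)$ for a prefix of $m$ qubits, and the mean of $2m$
over $m=1,\dots,n-1$ is $n$. -/

/-! ### Scalar inequalities and the classical Fannes-type bound. -/

open Real in
theorem negMulLog_sub_le_of_le {p q : ℝ} (hq : 0 ≤ q) (hqp : q ≤ p) :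
    negMulLog p - negMulLog q ≤ negMulLog (p - q) := by
  rcases hq.eq_or_lt with rfl | hq
  · simp
  rcases hqp.eq_or_lt with rfl | hqp
  · simp
  have h1 : log q ≤ log p := log_le_log hq hqp.le
  have h2 : log (p - q) ≤ log p := log_le_log (by linarith) (by linarith)
  have h3 : 0 < p - q := by linarith
  simp only [negMulLog]
  nlinarith [mul_le_mul_of_nonneg_left h1 hq.le, mul_le_mul_of_nonneg_left h2 h3.le]

-- The derivative $-\log x-1$ of `negMulLog` is at least $-1$ on $(0,1]$.
open Real in
theorem negMulLog_sub_le_sub {p q : ℝ} (hp : 0 ≤ p) (hpq : p ≤ q) (hq : q ≤ 1) :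
    negMulLog p - negMulLog q ≤ q - p := by
  rcases hp.eq_or_lt with rfl | hp
  · have := mul_log_nonpos hpq hq
    simp only [negMulLog]
    nlinarith
  have hq0 : 0 < q := hp.trans_le hpq
  have h1 : log (q / p) ≤ q / p - 1 := log_le_sub_one_of_pos (by positivity)
  rw [log_div hq0.ne' hp.ne'] at h1
  have h2 : p * (log q - log p) ≤ q - p := by
    calc _ ≤ p * (q / p - 1) := by gcongr
      _ = q - p := by field_simp
  have h3 : (q - p) * log q ≤ 0 :=
    mul_nonpos_of_nonneg_of_nonpos (by linarith) (log_nonpos hq0.le hq)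
  simp only [negMulLog]
  nlinarith

open Real in
/-- Among nonnegative families on `s` with a given sum, the constant one has the largest entropy. -/
theorem sum_negMulLog_le_mul_log_card_add {ι : Type*} (s : Finset ι) (r : ι → ℝ)
    (hr : ∀ i ∈ s, 0 ≤ r i) (hs : 0 < ∑ i ∈ s, r i) :
    ∑ i ∈ s, negMulLog (r i) ≤ (∑ i ∈ s, r i) * log s.card + negMulLog (∑ i ∈ s, r i) := by
  set T := ∑ i ∈ s, r i with hT
  have hne : s.Nonempty := by
    by_contra h
    rw [Finset.not_nonempty_iff_eq_empty] at h
    simp [hT, h] at hs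
  have hc : (0 : ℝ) < s.card := by exact_mod_cast hne.card_pos
  -- Gibbs' inequality against the uniform family; the error terms $T/|s|-r_i$ sum to zero.
  have key : ∀ i ∈ s, negMulLog (r i) ≤ r i * (log s.card - log T) + (T / s.card - r i) := by
    intro i hi
    rcases (hr i hi).eq_or_lt with h | h
    · rw [← h]
      simp
      positivity
    have h1 : log (T / s.card / r i) ≤ T / s.card / r i - 1 :=
      log_le_sub_one_of_pos (by positivity)
    rw [log_div (by positivity) h.ne', log_div hs.ne' hc.ne'] at h1
    have h2 := mul_le_mul_of_nonneg_left h1 h.le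
    have h3 : r i * (T / s.card / r i - 1) = T / s.card - r i := by field_simp
    rw [h3] at h2
    simp only [negMulLog]
    nlinarith
  refine (Finset.sum_le_sum key).trans (le_of_eq ?_)
  rw [Finset.sum_add_distrib, ← Finset.sum_mul, Finset.sum_sub_distrib, Finset.sum_const, ← hT,
    nsmul_eq_mul, mul_div_cancel₀ _ hc.ne']
  simp only [negMulLog]
  ring

open Real in
/-- A Fannes-type bound for the entropies of two probability vectors. -/
theorem sum_negMulLog_sub_le {ι : Type*} [Fintype ι] (p q : ι → ℝ) (hp : ∀ i, 0 ≤ p i)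
    (hq : ∀ i, 0 ≤ q i) (hp1 : ∑ i, p i = 1) (hq1 : ∑ i, q i = 1) :
    ∑ i, negMulLog (p i) - ∑ i, negMulLog (q i) ≤
      (1 / 2 * ∑ i, |p i - q i|) * (log ((Fintype.card ι : ℝ) - 1) + 1) +
        negMulLog (1 / 2 * ∑ i, |p i - q i|) := by
  classical
  set T := 1 / 2 * ∑ i, |p i - q i| with hT
  set s : Finset ι := Finset.univ.filter fun i => q i < p i with hs
  have hqle : ∀ i, q i ≤ 1 := fun i => hq1 ▸ Finset.single_le_sum (fun j _ => hq j) (Finset.mem_univ i)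
  have h0 : ∑ i, (p i - q i) = 0 := by rw [Finset.sum_sub_distrib, hp1, hq1, sub_self]
  have hsplit : ∑ i ∈ s, (p i - q i) + ∑ i ∈ sᶜ, (p i - q i) = 0 := by
    rw [Finset.sum_add_sum_compl, h0]
  have hle : ∀ i ∈ sᶜ, p i ≤ q i := fun i hi => by simpa [hs] using hi
  have hlt : ∀ i ∈ s, q i < p i := fun i hi => by simpa [hs] using hi
  have habs : ∑ i ∈ s, (p i - q i) - ∑ i ∈ sᶜ, (p i - q i) = 2 * T := by
    have e1 : ∑ i ∈ s, |p i - q i| = ∑ i ∈ s, (p i - q i) :=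
      Finset.sum_congr rfl fun i hi => abs_of_pos (by linarith [hlt i hi])
    have e2 : ∑ i ∈ sᶜ, |p i - q i| = -∑ i ∈ sᶜ, (p i - q i) := by
      rw [← Finset.sum_neg_distrib]
      exact Finset.sum_congr rfl fun i hi => abs_of_nonpos (by linarith [hle i hi])
    have := Finset.sum_add_sum_compl s fun i => |p i - q i|
    rw [e1, e2] at this
    rw [hT]
    linarith
  have hsT : ∑ i ∈ s, (p i - q i) = T := by linarith
  have hscT : ∑ i ∈ sᶜ, (q i - p i) = T := by
    have : ∑ i ∈ sᶜ, (q i - p i) = -∑ i ∈ sᶜ, (p i - q i) := by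
      rw [← Finset.sum_neg_distrib]; simp
    linarith
  have hmain : ∑ i, negMulLog (p i) - ∑ i, negMulLog (q i) ≤ ∑ i ∈ s, negMulLog (p i - q i) + T := by
    rw [← Finset.sum_sub_distrib, ← Finset.sum_add_sum_compl s]
    refine add_le_add (Finset.sum_le_sum fun i hi => ?_) (hscT ▸ Finset.sum_le_sum fun i hi => ?_)
    · exact negMulLog_sub_le_of_le (hq i) (hlt i hi).le
    · exact negMulLog_sub_le_sub (hp i) (hle i hi) (hqle i)
  have hT0 : 0 ≤ T := by positivity
  -- The maximum-entropy bound needs positive total mass, so $T=0$ is treated apart.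
  rcases hT0.eq_or_lt with hT0 | hT0
  · have hse : s = ∅ := by
      by_contra h
      have := Finset.sum_pos (fun i hi => sub_pos.2 (hlt i hi)) (Finset.nonempty_iff_ne_empty.2 h)
      linarith
    rw [hse, ← hT0] at hmain
    rw [← hT0]
    simpa using hmain
  have hne : s ≠ Finset.univ := by
    intro h
    rw [h, h0] at hsT
    linarith
  have hspos : 0 < s.card := by
    rw [Finset.card_pos, Finset.nonempty_iff_ne_empty]
    intro h
    rw [h] at hsT
    simp at hsT
    linarith
  -- The totals agree, so $p>q$ cannot hold at every index; this saves one in the cardinality.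
  have hcard : (s.card : ℝ) ≤ (Fintype.card ι : ℝ) - 1 := by
    have : s.card + 1 ≤ Fintype.card ι := Finset.card_lt_univ_of_notMem
      (Classical.not_forall.1 fun h => hne (Finset.eq_univ_iff_forall.2 h)).choose_spec
    have : (s.card : ℝ) + 1 ≤ Fintype.card ι := by exact_mod_cast this
    linarith
  have h1 := sum_negMulLog_le_mul_log_card_add s (fun i => p i - q i)
    (fun i hi => by linarith [hlt i hi]) (by rw [hsT]; exact hT0)
  rw [hsT] at h1
  have h2 : log s.card ≤ log ((Fintype.card ι : ℝ) - 1) :=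
    log_le_log (by exact_mod_cast hspos) hcard
  have h3 := mul_le_mul_of_nonneg_left h2 hT0.le
  linarith

-- `negMulLog` increases on $[0,1/e]$. This is the only use of the threshold $1/e$.
open Real in
theorem mul_add_negMulLog_le_of_le {s t c : ℝ} (hs : 0 ≤ s) (hst : s ≤ t) (ht : t ≤ 1 / exp 1)
    (hc : 0 ≤ c) : s * c + negMulLog s ≤ t * c + negMulLog t := by
  have h1 : s * c ≤ t * c := by gcongr
  suffices negMulLog s ≤ negMulLog t by linarith
  rcases hs.eq_or_lt with rfl | hs
  · rw [negMulLog_zero]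
    exact negMulLog_nonneg hst (ht.trans ((div_le_one (exp_pos 1)).2 (one_le_exp zero_le_one)))
  have ht0 := hs.trans_le hst
  have h2 : log t ≤ -1 := by
    have := log_le_log ht0 ht
    rwa [one_div, log_inv, log_exp] at this
  have h3 : log (t / s) ≤ t / s - 1 := log_le_sub_one_of_pos (by positivity)
  rw [log_div ht0.ne' hs.ne'] at h3
  have h4 : s * (log t - log s) ≤ t - s := by
    calc _ ≤ s * (t / s - 1) := by gcongr
      _ = t - s := by field_simp
  simp only [negMulLog]
  nlinarith

-- Averaging over cuts can afford the factor 2, which absorbs the additive 1. For $m=1$ the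
-- subtracted 1 is essential: $1\le 2\log 2$, whereas $\log 2+1>2\log 2$.
open Real in
theorem log_two_pow_sub_one_add_one_le {m : ℕ} (hm : 1 ≤ m) :
    log ((2 : ℝ) ^ m - 1) + 1 ≤ 2 * m * log 2 := by
  have h2 := log_two_gt_d9
  rcases hm.eq_or_lt with rfl | hm
  · norm_num
    linarith
  have h3 : (2 : ℝ) ≤ m := by exact_mod_cast hm
  have h4 : log ((2 : ℝ) ^ m - 1) ≤ m * log 2 := by
    rw [← log_pow]
    exact log_le_log (sub_pos.2 (one_lt_pow₀ one_lt_two (by omega))) (by linarith)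
  nlinarith

/-! ### Spectral formulas and measurement in an orthonormal basis. -/

theorem Matrix.IsHermitian.trace_cfc {ι : Type*} [Fintype ι] [DecidableEq ι] {A : Matrix ι ι ℂ}
    (hA : A.IsHermitian) (f : ℝ → ℝ) :
    (cfc f A).trace = ∑ i, (f (hA.eigenvalues i) : ℂ) := by
  rw [hA.cfc_eq, Matrix.IsHermitian.cfc, Unitary.conjStarAlgAut_apply, Matrix.trace_mul_comm,
    ← mul_assoc]
  simp [Matrix.trace]

/-- The spectrum is finite, so the functional calculus also accepts `Real.logb 2`, discontinuous at
0. -/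
theorem cfc_continuousOn_spectrum {ι : Type*} [Fintype ι] [DecidableEq ι] (A : Matrix ι ι ℂ)
    (f : ℝ → ℝ) : ContinuousOn f (spectrum ℝ A) :=
  (Matrix.finite_real_spectrum (A := A)).continuousOn f

theorem trNorm_eq_trace_cfc_abs {ι : Type*} [Fintype ι] [DecidableEq ι] {X : Matrix ι ι ℂ}
    (hX : X.IsHermitian) : trNorm X = 1 / 2 * (cfc (fun x : ℝ => |x|) X).trace.re := by
  have h : Xᴴ * X = cfc (fun x : ℝ => x ^ 2) X := by
    rw [hX.eq, cfc_pow_id X 2 hX.isSelfAdjoint, sq]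
  rw [trNorm, h, ← cfc_comp' Real.sqrt (fun x : ℝ => x ^ 2) X
    (((Matrix.finite_real_spectrum (A := X)).image _).continuousOn _)
    (cfc_continuousOn_spectrum _ _) hX.isSelfAdjoint]
  simp only [Real.sqrt_sq_eq_abs]

theorem trNorm_eq_sum_abs_eigenvalues {ι : Type*} [Fintype ι] [DecidableEq ι] {X : Matrix ι ι ℂ}
    (hX : X.IsHermitian) : trNorm X = 1 / 2 * ∑ i, |hX.eigenvalues i| := by
  rw [trNorm_eq_trace_cfc_abs hX, hX.trace_cfc, ← Complex.ofReal_sum, Complex.ofReal_re]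

/-- Replaces the logarithm by a function continuous on all of ℝ, as continuity in the state
requires. -/
theorem vonNeumannEntropy_eq_trace_cfc {ι : Type*} [Fintype ι] [DecidableEq ι] {ρ : Matrix ι ι ℂ}
    (hρ : ρ.IsHermitian) : vonNeumannEntropy ρ = (cfc Real.negMulLog ρ).trace.re / Real.log 2 := by
  have h : ρ * cfc (Real.logb 2) ρ = cfc (fun x => x * Real.logb 2 x) ρ := by
    rw [cfc_mul (fun x => x) (Real.logb 2) ρ (cfc_continuousOn_spectrum _ _)
      (cfc_continuousOn_spectrum _ _), cfc_id' ℝ ρ hρ.isSelfAdjoint]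
  rw [vonNeumannEntropy, h, hρ.trace_cfc, hρ.trace_cfc, ← Complex.ofReal_sum, ← Complex.ofReal_sum,
    Complex.ofReal_re, Complex.ofReal_re, Finset.sum_div, ← Finset.sum_neg_distrib]
  refine Finset.sum_congr rfl fun i _ => ?_
  simp only [Real.negMulLog, Real.logb]
  ring

theorem vonNeumannEntropy_eq_sum {ι : Type*} [Fintype ι] [DecidableEq ι] {ρ : Matrix ι ι ℂ}
    (hρ : ρ.IsHermitian) :
    vonNeumannEntropy ρ = (∑ i, Real.negMulLog (hρ.eigenvalues i)) / Real.log 2 := by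
  rw [vonNeumannEntropy_eq_trace_cfc hρ, hρ.trace_cfc, ← Complex.ofReal_sum, Complex.ofReal_re]

/-- The expectation value `⟨f|A|f⟩`. -/
def quadForm {ι : Type*} [Fintype ι] (A : Matrix ι ι ℂ) (f : ι → ℂ) : ℂ := star f ⬝ᵥ (A *ᵥ f)

theorem quadForm_sub {ι : Type*} [Fintype ι] (A B : Matrix ι ι ℂ) (f : ι → ℂ) :
    quadForm (A - B) f = quadForm A f - quadForm B f := by
  simp only [quadForm, Matrix.sub_mulVec, dotProduct_sub]

theorem Matrix.IsHermitian.quadForm_eq_sum {ι : Type*} [Fintype ι] [DecidableEq ι]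
    {A : Matrix ι ι ℂ} (hA : A.IsHermitian) (f : ι → ℂ) :
    quadForm A f =
      ((∑ j, hA.eigenvalues j * ‖inner ℂ (WithLp.toLp 2 f) (hA.eigenvectorBasis j)‖ ^ 2 : ℝ) : ℂ) := by
  have hf : f = ∑ j, inner ℂ (hA.eigenvectorBasis j) (WithLp.toLp 2 f) •
      (hA.eigenvectorBasis j : EuclideanSpace ℂ ι).ofLp := by
    have := congrArg WithLp.ofLp (hA.eigenvectorBasis.sum_repr' (WithLp.toLp 2 f))
    simpa using this.symm
  have h1 : ∀ j, star f ⬝ᵥ (hA.eigenvectorBasis j).ofLp =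
      inner ℂ (WithLp.toLp 2 f) (hA.eigenvectorBasis j) := fun j => by
    rw [EuclideanSpace.inner_eq_star_dotProduct, dotProduct_comm]
  rw [quadForm]
  conv_lhs => rw [hf, ← hf]
  conv_lhs => arg 2; rw [hf]
  rw [Matrix.mulVec_sum, dotProduct_sum, Complex.ofReal_sum]
  refine Finset.sum_congr rfl fun j _ => ?_
  rw [Matrix.mulVec_smul, hA.mulVec_eigenvectorBasis, dotProduct_smul, dotProduct_smul, h1,
    ← inner_conj_symm, Complex.ofReal_mul, Complex.ofReal_pow, ← Complex.mul_conj']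
  simp
  ring

theorem Matrix.IsHermitian.quadForm_eigenvectorBasis {ι : Type*} [Fintype ι] [DecidableEq ι]
    {A : Matrix ι ι ℂ} (hA : A.IsHermitian) (i : ι) :
    quadForm A (hA.eigenvectorBasis i).ofLp = hA.eigenvalues i := by
  rw [hA.quadForm_eq_sum, Finset.sum_eq_single i]
  · simp [hA.eigenvectorBasis.orthonormal.1 i, inner_self_eq_norm_sq_to_K]
  · intro j _ hj
    simp [hA.eigenvectorBasis.orthonormal.2 hj.symm]
  · simp

theorem OrthonormalBasis.sum_quadForm {ι : Type*} [Fintype ι] [DecidableEq ι]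
    (b : OrthonormalBasis ι ℂ (EuclideanSpace ℂ ι)) {A : Matrix ι ι ℂ} (hA : A.IsHermitian) :
    ∑ i, (quadForm A (b i).ofLp).re = ∑ i, hA.eigenvalues i := by
  simp only [hA.quadForm_eq_sum, Complex.ofReal_re, WithLp.toLp_ofLp]
  rw [Finset.sum_comm]
  refine Finset.sum_congr rfl fun j _ => ?_
  rw [← Finset.mul_sum, b.sum_sq_norm_inner_right, hA.eigenvectorBasis.orthonormal.1 j]
  simp

/-- Measuring a state in an orthonormal basis does not decrease the entropy. -/
theorem OrthonormalBasis.sum_negMulLog_eigenvalues_le {ι : Type*} [Fintype ι] [DecidableEq ι]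
    (b : OrthonormalBasis ι ℂ (EuclideanSpace ℂ ι)) {A : Matrix ι ι ℂ} (hA : A.IsHermitian)
    (hpos : ∀ j, 0 ≤ hA.eigenvalues j) :
    ∑ j, Real.negMulLog (hA.eigenvalues j) ≤
      ∑ i, Real.negMulLog (quadForm A (b i).ofLp).re := by
  -- The squared overlaps of two orthonormal bases are doubly stochastic: row sums 1 permit Jensen
  -- here, column sums 1 restore the entropy after summing over `i`.
  have h1 : ∀ i, ∑ j, ‖inner ℂ (b i) (hA.eigenvectorBasis j)‖ ^ 2 *
      Real.negMulLog (hA.eigenvalues j) ≤ Real.negMulLog (quadForm A (b i).ofLp).re := by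
    intro i
    rw [hA.quadForm_eq_sum, Complex.ofReal_re, WithLp.toLp_ofLp]
    have := Real.concaveOn_negMulLog.le_map_sum (t := Finset.univ)
      (w := fun j => ‖inner ℂ (b i) (hA.eigenvectorBasis j)‖ ^ 2) (p := hA.eigenvalues)
      (fun j _ => by positivity)
      (by rw [hA.eigenvectorBasis.sum_sq_norm_inner_left, b.orthonormal.1 i, one_pow])
      (fun j _ => hpos j)
    simpa only [smul_eq_mul, mul_comm] using this
  refine le_trans (le_of_eq ?_) (Finset.sum_le_sum fun i _ => h1 i)
  rw [Finset.sum_comm]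
  refine Finset.sum_congr rfl fun j _ => ?_
  rw [← Finset.sum_mul, b.sum_sq_norm_inner_right, hA.eigenvectorBasis.orthonormal.1 j]
  simp

/-! ### Partial traces. -/

theorem Matrix.IsHermitian.partialTraceRight_reindex {N α β : Type*} [Fintype N] [Fintype β]
    (e : N ≃ α × β) {X : Matrix N N ℂ} (hX : X.IsHermitian) :
    (partialTraceRight (Matrix.reindex e e X)).IsHermitian := by
  ext a a'
  simp only [partialTraceRight, Matrix.conjTranspose_apply, Matrix.of_apply, star_sum,
    Matrix.reindex_apply, Matrix.submatrix_apply, hX.apply]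

theorem trace_partialTraceRight_reindex {N α β : Type*} [Fintype N] [Fintype α] [Fintype β]
    (e : N ≃ α × β) (X : Matrix N N ℂ) :
    (partialTraceRight (Matrix.reindex e e X)).trace = X.trace := by
  simp only [Matrix.trace, Matrix.diag, partialTraceRight, Matrix.of_apply, Matrix.reindex_apply,
    Matrix.submatrix_apply]
  rw [← Fintype.sum_prod_type' fun a b => X (e.symm (a, b)) (e.symm (a, b))]
  exact e.symm.sum_comp fun x => X x x

theorem partialTraceRight_reindex_sub {N α β : Type*} [Fintype β]
    (e : N ≃ α × β) (X Y : Matrix N N ℂ) :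
    partialTraceRight (Matrix.reindex e e (X - Y)) =
      partialTraceRight (Matrix.reindex e e X) - partialTraceRight (Matrix.reindex e e Y) := by
  ext a a'
  simp [partialTraceRight]

/-- The product vector `f ⊗ |b⟩`, with the index set split by `e`. -/
def tensorBasisVec {N α β : Type*} [DecidableEq β] (e : N ≃ α × β) (f : α → ℂ) (b : β) : N → ℂ :=
  fun x => if (e x).2 = b then f (e x).1 else 0

theorem star_tensorBasisVec_dotProduct {N α β : Type*} [Fintype N] [Fintype α] [Fintype β]
    [DecidableEq β] (e : N ≃ α × β) (f : α → ℂ) (b : β) (v : N → ℂ) :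
    star (tensorBasisVec e f b) ⬝ᵥ v = star f ⬝ᵥ fun a => v (e.symm (a, b)) := by
  simp only [dotProduct]
  rw [← e.symm.sum_comp, Fintype.sum_prod_type]
  refine Finset.sum_congr rfl fun a _ => ?_
  rw [Finset.sum_eq_single b]
  · simp [tensorBasisVec]
  · intro b' _ hb'
    simp [tensorBasisVec, hb']
  · simp

/-- Pulls expectations in a reduced state back to the full system, where positivity and the spectral
decomposition are available. -/
theorem quadForm_partialTraceRight_reindex {N α β : Type*} [Fintype N] [Fintype α] [Fintype β]
    [DecidableEq β] (e : N ≃ α × β) (X : Matrix N N ℂ) (f : α → ℂ) :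
    quadForm (partialTraceRight (Matrix.reindex e e X)) f =
      ∑ b, quadForm X (tensorBasisVec e f b) := by
  have h : ∀ b x, (X *ᵥ tensorBasisVec e f b) x = ∑ a, X x (e.symm (a, b)) * f a := by
    intro b x
    simp only [Matrix.mulVec, dotProduct]
    rw [← e.symm.sum_comp, Fintype.sum_prod_type]
    refine Finset.sum_congr rfl fun a _ => ?_
    rw [Finset.sum_eq_single b]
    · simp [tensorBasisVec]
    · intro b' _ hb'
      simp [tensorBasisVec, hb']
    · simp
  simp only [quadForm, star_tensorBasisVec_dotProduct, h]
  rw [← dotProduct_sum]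
  congr 1
  ext a
  simp only [Matrix.mulVec, dotProduct, partialTraceRight, Matrix.of_apply, Matrix.reindex_apply,
    Matrix.submatrix_apply, Finset.sum_mul, Finset.sum_apply]
  exact Finset.sum_comm

/-- The trace norm does not increase under a partial trace followed by a measurement. -/
theorem OrthonormalBasis.sum_abs_quadForm_partialTraceRight_le {N α β : Type*} [Fintype N]
    [DecidableEq N] [Fintype α] [DecidableEq α] [Fintype β] [DecidableEq β] (e : N ≃ α × β)
    (f : OrthonormalBasis α ℂ (EuclideanSpace ℂ α)) {X : Matrix N N ℂ} (hX : X.IsHermitian) :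
    1 / 2 * ∑ i, |(quadForm (partialTraceRight (Matrix.reindex e e X)) (f i).ofLp).re| ≤
      trNorm X := by
  rw [trNorm_eq_sum_abs_eigenvalues hX]
  refine mul_le_mul_of_nonneg_left ?_ (by norm_num)
  -- `w i j` is the probability of outcome `i` when the reduced state of eigenvector `j` is
  -- measured, so it sums to 1 over `i`.
  set w : α → N → ℝ := fun i j =>
    ∑ b, ‖inner ℂ (WithLp.toLp 2 (tensorBasisVec e (f i).ofLp b)) (hX.eigenvectorBasis j)‖ ^ 2
    with hw
  have hw0 : ∀ i j, 0 ≤ w i j := fun i j => by positivity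
  have hq : ∀ i, (quadForm (partialTraceRight (Matrix.reindex e e X)) (f i).ofLp).re =
      ∑ j, hX.eigenvalues j * w i j := by
    intro i
    rw [quadForm_partialTraceRight_reindex, Complex.re_sum]
    simp only [hX.quadForm_eq_sum, Complex.ofReal_re]
    rw [Finset.sum_comm]
    simp only [hw, Finset.mul_sum]
  have hsum : ∀ j, ∑ i, w i j = 1 := by
    intro j
    simp only [hw]
    rw [Finset.sum_comm]
    have h1 : ∀ b i, inner ℂ (WithLp.toLp 2 (tensorBasisVec e (f i).ofLp b))
        (hX.eigenvectorBasis j) =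
        inner ℂ (f i) (WithLp.toLp 2 fun a => (hX.eigenvectorBasis j).ofLp (e.symm (a, b))) := by
      intro b i
      rw [EuclideanSpace.inner_eq_star_dotProduct, EuclideanSpace.inner_eq_star_dotProduct,
        dotProduct_comm, star_tensorBasisVec_dotProduct, dotProduct_comm]
    simp only [h1, f.sum_sq_norm_inner_right, EuclideanSpace.norm_sq_eq]
    rw [Finset.sum_comm, ← Fintype.sum_prod_type' fun a b =>
      ‖(hX.eigenvectorBasis j).ofLp (e.symm (a, b))‖ ^ 2,
      e.symm.sum_comp fun x => ‖(hX.eigenvectorBasis j).ofLp x‖ ^ 2, ← EuclideanSpace.norm_sq_eq,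
      hX.eigenvectorBasis.orthonormal.1 j, one_pow]
  calc ∑ i, |(quadForm (partialTraceRight (Matrix.reindex e e X)) (f i).ofLp).re|
      ≤ ∑ i, ∑ j, |hX.eigenvalues j| * w i j := by
        refine Finset.sum_le_sum fun i _ => ?_
        rw [hq]
        refine (Finset.abs_sum_le_sum_abs _ _).trans (le_of_eq (Finset.sum_congr rfl fun j _ => ?_))
        rw [abs_mul, abs_of_nonneg (hw0 i j)]
    _ = ∑ j, |hX.eigenvalues j| := by
        rw [Finset.sum_comm]
        refine Finset.sum_congr rfl fun j _ => ?_
        rw [← Finset.mul_sum, hsum, mul_one]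

/-! ### Reduced states of qustrings and the entropy estimate. -/

theorem trNorm_sub_comm {ι : Type*} [Fintype ι] [DecidableEq ι] (X Y : Matrix ι ι ℂ) :
    trNorm (X - Y) = trNorm (Y - X) := by
  rw [trNorm, trNorm, ← neg_sub Y X, Matrix.conjTranspose_neg, neg_mul_neg]

theorem trNorm_nonneg {ι : Type*} [Fintype ι] [DecidableEq ι] {X : Matrix ι ι ℂ}
    (hX : X.IsHermitian) : 0 ≤ trNorm X := by
  rw [trNorm_eq_sum_abs_eigenvalues hX]
  positivity

theorem isHermitian_ketbra {n : ℕ} (φ : Qustring n) : (ketbra φ).IsHermitian := by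
  ext x y
  simp [ketbra, mul_comm]

theorem trace_ketbra {n : ℕ} (φ : Qustring n) : (ketbra φ).trace = 1 := by
  have h : ∑ x, ‖(φ : QubitSpace n) x‖ ^ 2 = 1 := by
    rw [← EuclideanSpace.norm_sq_eq, norm_eq_of_mem_sphere φ, one_pow]
  simp only [Matrix.trace, Matrix.diag, ketbra, Matrix.of_apply, RCLike.star_def, Complex.mul_conj']
  exact_mod_cast h

theorem quadForm_ketbra_re_nonneg {n : ℕ} (φ : Qustring n) (g : (Fin n → Bool) → ℂ) :
    0 ≤ (quadForm (ketbra φ) g).re := by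
  have h : quadForm (ketbra φ) g =
      (star g ⬝ᵥ (φ : QubitSpace n).ofLp) * star (star g ⬝ᵥ (φ : QubitSpace n).ofLp) := by
    simp only [quadForm, ketbra, dotProduct, Matrix.mulVec, Matrix.of_apply, star_sum, star_mul',
      Pi.star_apply, star_star]
    rw [Finset.sum_mul_sum]
    refine Finset.sum_congr rfl fun x _ => ?_
    rw [Finset.mul_sum]
    exact Finset.sum_congr rfl fun y _ => by ring
  rw [h, RCLike.star_def, Complex.mul_conj]
  exact Complex.normSq_nonneg _

theorem isHermitian_traceOutFrom {n : ℕ} (i : ℕ) {ρ : Matrix (Fin n → Bool) (Fin n → Bool) ℂ}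
    (hρ : ρ.IsHermitian) : (traceOutFrom i ρ).IsHermitian :=
  Matrix.IsHermitian.partialTraceRight_reindex _ hρ

theorem quadForm_traceOutFrom_ketbra_re_nonneg {n : ℕ} (i : ℕ) (φ : Qustring n)
    (g : ({q : Fin n // (q : ℕ) + 1 < i} → Bool) → ℂ) :
    0 ≤ (quadForm (traceOutFrom i (ketbra φ)) g).re := by
  rw [traceOutFrom, quadForm_partialTraceRight_reindex, Complex.re_sum]
  exact Finset.sum_nonneg fun b _ => quadForm_ketbra_re_nonneg φ _

theorem eigenvalues_traceOutFrom_ketbra_nonneg {n : ℕ} (i : ℕ) (φ : Qustring n)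
    (j : {q : Fin n // (q : ℕ) + 1 < i} → Bool) :
    0 ≤ (isHermitian_traceOutFrom i (isHermitian_ketbra φ)).eigenvalues j := by
  have h := quadForm_traceOutFrom_ketbra_re_nonneg i φ
    ((isHermitian_traceOutFrom i (isHermitian_ketbra φ)).eigenvectorBasis j).ofLp
  rwa [Matrix.IsHermitian.quadForm_eigenvectorBasis, Complex.ofReal_re] at h

theorem sum_eigenvalues_traceOutFrom_ketbra {n : ℕ} (i : ℕ) (φ : Qustring n) :
    ∑ j, (isHermitian_traceOutFrom i (isHermitian_ketbra φ)).eigenvalues j = 1 := by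
  have h := (isHermitian_traceOutFrom i (isHermitian_ketbra φ)).trace_eq_sum_eigenvalues
  have h1 : (traceOutFrom i (ketbra φ)).trace = 1 :=
    (trace_partialTraceRight_reindex _ _).trans (trace_ketbra φ)
  rw [h1] at h
  simpa using (congrArg Complex.re h).symm

theorem card_prefix_strings {n i : ℕ} (hi : i ≤ n) :
    Fintype.card ({q : Fin n // (q : ℕ) + 1 < i} → Bool) = 2 ^ (i - 1) := by
  rw [Fintype.card_fun, Fintype.card_bool]
  congr 1
  calc Fintype.card {q : Fin n // (q : ℕ) + 1 < i}
      = Fintype.card (Fin (i - 1)) := Fintype.card_congr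
        { toFun := fun q => ⟨q.1, by have := q.2; omega⟩
          invFun := fun q => ⟨⟨q, by have := q.2; omega⟩, by have := q.2; simp only; omega⟩
          left_inv := fun q => rfl
          right_inv := fun q => rfl }
    _ = i - 1 := Fintype.card_fin _

-- In the eigenbasis of the reduced state of `ψ`, the outcome distribution of `ψ` is its spectrum,
-- while that of `φ` has at least the entropy of its reduced state. The classical bound for these
-- two distributions suffices.
open Real in
theorem vonNeumannEntropy_traceOutFrom_sub_le {n i : ℕ} (hi2 : 2 ≤ i) (hin : i ≤ n)
    (φ ψ : Qustring n) (hT : trNorm (ketbra φ - ketbra ψ) ≤ 1 / exp 1) :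
    vonNeumannEntropy (traceOutFrom i (ketbra φ)) - vonNeumannEntropy (traceOutFrom i (ketbra ψ)) ≤
      trNorm (ketbra φ - ketbra ψ) *
        (2 * ((i : ℝ) - 1) - logb 2 (trNorm (ketbra φ - ketbra ψ))) := by
  set T := trNorm (ketbra φ - ketbra ψ) with hTdef
  have hφ := isHermitian_traceOutFrom i (isHermitian_ketbra φ)
  have hψ := isHermitian_traceOutFrom i (isHermitian_ketbra ψ)
  set b := hψ.eigenvectorBasis
  set p := fun j => (quadForm (traceOutFrom i (ketbra φ)) (b j).ofLp).re
  have hl2 : 0 < log 2 := log_pos one_lt_two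
  have h1 := b.sum_negMulLog_eigenvalues_le hφ (eigenvalues_traceOutFrom_ketbra_nonneg i φ)
  have h2 := sum_negMulLog_sub_le p hψ.eigenvalues
    (fun j => quadForm_traceOutFrom_ketbra_re_nonneg i φ _)
    (eigenvalues_traceOutFrom_ketbra_nonneg i ψ)
    ((b.sum_quadForm hφ).trans (sum_eigenvalues_traceOutFrom_ketbra i φ))
    (sum_eigenvalues_traceOutFrom_ketbra i ψ)
  have h3 : 1 / 2 * ∑ j, |p j - hψ.eigenvalues j| ≤ T := by
    refine le_trans (le_of_eq ?_) (b.sum_abs_quadForm_partialTraceRight_le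
      (Equiv.piEquivPiSubtypeProd (fun q : Fin n => (q : ℕ) + 1 < i) fun _ => Bool)
      ((isHermitian_ketbra φ).sub (isHermitian_ketbra ψ)))
    congr 1
    refine Finset.sum_congr rfl fun j _ => ?_
    rw [partialTraceRight_reindex_sub, quadForm_sub, Complex.sub_re]
    congr 2
    exact (congrArg Complex.re (hψ.quadForm_eigenvectorBasis j)).symm
  -- `m` counts the qubits kept, so the dimension is $2^m$.
  obtain ⟨m, rfl⟩ : ∃ m, i = m + 1 := ⟨i - 1, by omega⟩
  have hm : 1 ≤ m := by omega
  have hc : (Fintype.card ({q : Fin n // (q : ℕ) + 1 < m + 1} → Bool) : ℝ) = 2 ^ m := by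
    rw [card_prefix_strings hin]
    simp
  rw [hc] at h2
  have h4 : 0 ≤ log ((2 : ℝ) ^ m - 1) := log_nonneg (by
    have : (2 : ℝ) ^ 1 ≤ 2 ^ m := pow_le_pow_right₀ one_le_two hm
    linarith)
  have h5 := mul_add_negMulLog_le_of_le (by positivity) h3 hT
    (show 0 ≤ log ((2 : ℝ) ^ m - 1) + 1 by linarith)
  have hT0 : 0 ≤ T := trNorm_nonneg ((isHermitian_ketbra φ).sub (isHermitian_ketbra ψ))
  have h6 := mul_le_mul_of_nonneg_left (log_two_pow_sub_one_add_one_le hm) hT0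
  rw [vonNeumannEntropy_eq_sum hφ, vonNeumannEntropy_eq_sum hψ, ← sub_div, div_le_iff₀ hl2]
  have h7 : T * (2 * (((m + 1 : ℕ) : ℝ) - 1) - logb 2 T) * log 2 =
      T * (2 * m * log 2) + negMulLog T := by
    rw [logb, negMulLog]
    push_cast
    field_simp
    ring
  rw [h7]
  linarith

open Real in
theorem abs_averageEntropy_sub_le {n : ℕ} (hn : 2 ≤ n) (φ ψ : Qustring n)
    (hT : trNorm (ketbra φ - ketbra ψ) ≤ 1 / exp 1) :
    |averageEntropy (ketbra φ) - averageEntropy (ketbra ψ)| ≤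
      trNorm (ketbra φ - ketbra ψ) * ((n : ℝ) - logb 2 (trNorm (ketbra φ - ketbra ψ))) := by
  set T := trNorm (ketbra φ - ketbra ψ) with hTdef
  have hn1 : (0 : ℝ) < (n : ℝ) - 1 := by
    have : (2 : ℝ) ≤ n := by exact_mod_cast hn
    linarith
  have hterm : ∀ i ∈ Finset.Icc 2 n, |vonNeumannEntropy (traceOutFrom i (ketbra φ)) -
      vonNeumannEntropy (traceOutFrom i (ketbra ψ))| ≤ T * (2 * ((i : ℝ) - 1) - logb 2 T) := by
    intro i hi
    obtain ⟨hi2, hin⟩ := Finset.mem_Icc.1 hi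
    rw [abs_le']
    refine ⟨vonNeumannEntropy_traceOutFrom_sub_le hi2 hin φ ψ hT, ?_⟩
    rw [neg_sub, hTdef, trNorm_sub_comm]
    exact vonNeumannEntropy_traceOutFrom_sub_le hi2 hin ψ φ (by rwa [trNorm_sub_comm])
  -- After division by $n-1$ this sum contributes exactly the `n` of the final bound.
  have hsum : ∀ N : ℕ, 1 ≤ N → ∑ i ∈ Finset.Icc 2 N, (2 * ((i : ℝ) - 1)) = ((N : ℝ) - 1) * N := by
    intro N hN
    induction N, hN using Nat.le_induction with
    | base => simp
    | succ N hN ih =>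
      rw [Finset.sum_Icc_succ_top (by omega), ih]
      push_cast
      ring
  rw [averageEntropy, averageEntropy, ← mul_sub, ← Finset.sum_sub_distrib, abs_mul,
    abs_of_pos (by positivity), one_div, inv_mul_le_iff₀ hn1]
  refine (Finset.abs_sum_le_sum_abs _ _).trans ((Finset.sum_le_sum hterm).trans (le_of_eq ?_))
  rw [← Finset.mul_sum, Finset.sum_sub_distrib, hsum n (by omega), Finset.sum_const, Nat.card_Icc,
    nsmul_eq_mul, Nat.cast_sub (by omega)]
  push_cast
  ring

/-! ### Continuity, and compactness of the separable set. -/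

open scoped Matrix.Norms.L2Operator in
theorem continuous_cfc_of_isHermitian {X ι : Type*} [TopologicalSpace X] [Fintype ι]
    [DecidableEq ι] {f : ℝ → ℝ} (hf : Continuous f) {A : X → Matrix ι ι ℂ} (hA : Continuous A)
    (hherm : ∀ x, (A x).IsHermitian) : Continuous fun x => cfc f (A x) :=
  hA.cfc_of_mem_nhdsSet (s := Set.univ) f (fun _ => by simp)
    (fun x => (hherm x).isSelfAdjoint) hf.continuousOn

theorem continuous_ketbra {n : ℕ} : Continuous (ketbra : Qustring n → _) := by
  refine continuous_matrix fun x y => ?_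
  simp only [ketbra, Matrix.of_apply]
  fun_prop

theorem continuous_trNorm_ketbra_sub {n : ℕ} (ξ : Qustring n) :
    Continuous fun φ : Qustring n => trNorm (ketbra ξ - ketbra φ) := by
  have hherm : ∀ φ : Qustring n, (ketbra ξ - ketbra φ).IsHermitian := fun φ =>
    (isHermitian_ketbra ξ).sub (isHermitian_ketbra φ)
  simp only [trNorm_eq_trace_cfc_abs (hherm _)]
  have := continuous_cfc_of_isHermitian continuous_abs
    (continuous_const.sub continuous_ketbra) hherm
  exact continuous_const.mul (Complex.continuous_re.comp this.matrix_trace)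

theorem continuous_averageEntropy_ketbra {n : ℕ} :
    Continuous fun φ : Qustring n => averageEntropy (ketbra φ) := by
  refine continuous_const.mul (continuous_finsetSum _ fun i _ => ?_)
  have hherm : ∀ φ : Qustring n, (traceOutFrom i (ketbra φ)).IsHermitian := fun φ =>
    isHermitian_traceOutFrom i (isHermitian_ketbra φ)
  simp only [vonNeumannEntropy_eq_trace_cfc (hherm _)]
  have hc : Continuous fun φ : Qustring n => traceOutFrom i (ketbra φ) := by
    refine continuous_matrix fun x y => ?_
    simp only [traceOutFrom, partialTraceRight, Matrix.of_apply, Matrix.reindex_apply,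
      Matrix.submatrix_apply]
    exact continuous_finsetSum _ fun b _ => continuous_ketbra.matrix_elem _ _
  have := continuous_cfc_of_isHermitian Real.continuous_negMulLog hc hherm
  exact (Complex.continuous_re.comp this.matrix_trace).div_const _

theorem continuous_permuteQubits {n : ℕ} (σ : Equiv.Perm (Fin n)) :
    Continuous (permuteQubits σ) := by
  refine (PiLp.continuous_toLp 2 _).comp (continuous_pi fun y => ?_)
  fun_prop

/-- Block lengths are at most `n`, so there are finitely many pairs `(m, σ)`. Each contributes the
preimage, under a continuous permutation, of the compact image of a product of spheres. -/
theorem isClosed_isKSeparable (n k : ℕ) : IsClosed {φ : Qustring n | IsKSeparable k φ} := by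
  have h : {φ : Qustring n | IsKSeparable k φ} =
      ⋃ (m : Fin k → Fin (n + 1)) (σ : Equiv.Perm (Fin n)),
        {φ : Qustring n | ∃ (hm : ∑ j, (m j : ℕ) = n) (ψ : ∀ j, Qustring (m j : ℕ)),
          (∀ j, 1 ≤ (m j : ℕ)) ∧ permuteQubits σ (φ : QubitSpace n) =
            tensorBlocks (fun j => (m j : ℕ)) hm fun j => (ψ j : QubitSpace (m j))} := by
    ext φ
    simp only [Set.mem_iUnion, Set.mem_ofPred_eq]
    constructor
    · rintro ⟨m, hm, ψ, σ, h1, h2⟩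
      have hlt : ∀ j, m j < n + 1 := fun j => by
        have := Finset.single_le_sum (f := m) (fun _ _ => Nat.zero_le _) (Finset.mem_univ j)
        omega
      exact ⟨fun j => ⟨m j, hlt j⟩, σ, hm, ψ, h1, h2⟩
    · rintro ⟨m, σ, hm, ψ, h1, h2⟩
      exact ⟨fun j => m j, hm, ψ, σ, h1, h2⟩
  rw [h]
  refine isClosed_iUnion_of_finite fun m => isClosed_iUnion_of_finite fun σ => ?_
  by_cases hm : ∑ j, (m j : ℕ) = n
  swap
  · simp [hm]
  by_cases h1 : ∀ j, 1 ≤ (m j : ℕ)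
  swap
  · simp [h1]
  have hc : Continuous fun ψ : ∀ j, Qustring (m j : ℕ) =>
      tensorBlocks (fun j => (m j : ℕ)) hm fun j => (ψ j : QubitSpace (m j)) := by
    refine (PiLp.continuous_toLp 2 _).comp (continuous_pi fun y => ?_)
    fun_prop
  have := (isCompact_range hc).isClosed.preimage
    ((continuous_permuteQubits σ).comp (continuous_subtype_val (p := (· ∈ Metric.sphere 0 1))))
  convert this using 1
  ext φ
  simp [hm, h1, eq_comm]

/-- The witness is $|0\cdots0\rangle$, cut into one block of length $n-k+1$ and $k-1$ single qubits.
-/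
theorem exists_isKSeparable {n k : ℕ} (hk : 1 ≤ k) (hkn : k ≤ n) :
    ∃ φ : Qustring n, IsKSeparable k φ := by
  let zero : ∀ m : ℕ, Qustring m := fun m =>
    ⟨EuclideanSpace.single (fun _ => false) 1, by simp⟩
  have hm : ∑ j : Fin k, (1 + if j = ⟨0, hk⟩ then n - k else 0) = n := by
    rw [Finset.sum_add_distrib, Finset.sum_ite_eq', if_pos (Finset.mem_univ _)]
    simp
    omega
  refine ⟨zero n, fun j => 1 + if j = ⟨0, hk⟩ then n - k else 0, hm, fun j => zero _, 1,
    fun j => Nat.le_add_right 1 _, ?_⟩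
  · ext y
    simp only [permuteQubits, tensorBlocks, zero, PiLp.single_apply]
    by_cases hy : y = fun _ => false
    · subst hy
      simp
    · obtain ⟨t, ht⟩ := Function.ne_iff.1 hy
      obtain ⟨⟨j, s⟩, hs⟩ := (finSigmaFinEquiv.trans (finCongr hm)).surjective t
      rw [Finset.prod_eq_zero (Finset.mem_univ j)]
      · exact if_neg hy
      · rw [if_neg]
        intro h
        exact ht (hs ▸ congrFun h s)

theorem mainTheorem11 (n : ℕ) (ξ : Qustring n) (k : ℕ) (hk2 : 2 ≤ k) (hkn : k ≤ n)
    (hξ : sdis k ξ ≤ 1 / Real.exp 1) :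
    ∃ δ : ℝ,
      IsLeast
        {d : ℝ | ∃ φ : Qustring n, IsKSeparable k φ ∧
          d = |averageEntropy (ketbra ξ) - averageEntropy (ketbra φ)|} δ ∧
      δ ≤ sdis k ξ * ((n : ℝ) - Real.logb 2 (sdis k ξ)) := by
  have hcomp : IsCompact {φ : Qustring n | IsKSeparable k φ} := (isClosed_isKSeparable n k).isCompact
  have hne : {φ : Qustring n | IsKSeparable k φ}.Nonempty := exists_isKSeparable (by omega) hkn
  obtain ⟨φ, hφ, hφmin⟩ := hcomp.exists_isMinOn hne
    (continuous_const.sub continuous_averageEntropy_ketbra).abs.continuousOn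
  obtain ⟨ψ, hψ, hψmin⟩ := hcomp.exists_isMinOn hne (continuous_trNorm_ketbra_sub ξ).continuousOn
  have hsdis : sdis k ξ = trNorm (ketbra ξ - ketbra ψ) := by
    refine IsLeast.csInf_eq ⟨⟨ψ, hψ, rfl⟩, ?_⟩
    rintro _ ⟨χ, hχ, rfl⟩
    exact hψmin hχ
  refine ⟨|averageEntropy (ketbra ξ) - averageEntropy (ketbra φ)|, ⟨⟨φ, hφ, rfl⟩, ?_⟩, ?_⟩
  · rintro _ ⟨χ, hχ, rfl⟩
    exact hφmin hχ
  · rw [hsdis] at hξ ⊢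
    -- The least entropy gap is at most the gap at `ψ`, the separable state nearest to `ξ`.
    exact (hφmin hψ).trans (abs_averageEntropy_sub_le (hk2.trans hkn) ξ ψ hξ)
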